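/- For integers $u\le w$ write $[u,w]$ for the set of integers $n$ with $u\le n\le w$. For a finite set $C$ of nonnegative integers let $\Delta C$ be the multiset of differences $p-q$ with $p,q\in C$, $p>q$; for a collection $\mathcal B$ of such sets (blocks) let $\Delta\mathcal B$ be the multiset union of the $\Delta C$, $C\in\mathcal B$. For odd $v$ and a set $K$ of positive integers, a $(v,K,1)$-PDF (perfect difference family) is a collection $\mathcal B$ of subsets of $\{0,1,\dots,v-1\}$ (representing $\mathbf Z_v$), with sizes in $K$, such that $\Delta\mathcal B$ consists of each of $1,2,\dots,\frac{v-1}2$ exactly once. A $(g,\{3,4\},1)$-PDF is of type $3^s4^t$ ($s\ge 0$, $t\ge 1$) if it has exactly $s$ blocks of size $3$ and $t$ blocks of size $4$; its ratio of $4$-blocks is $\theta=\frac{t}{s+t}$. A variable $(12t+1,4,1)$-PDF is a $(12t+1,\{4\},1)$-PDF with blocks $B_i=\{0,a_i,b_i,c_i\}$, $0<a_i<b_i<c_i$, $1\le i\le t$, such that for every integer $x\ge 0$ the differences of the blocks $B_i(x)=\{0,a_i,x+b_i,x+c_i\}$, $1\le i\le t$, consist of each element of $[1,2t]\cup[x+2t+1,x+6t]$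 exactly once. A perfect Langford sequence $\mathrm{PLS}(s,m)$ is given by a partition of $\{1,2,\dots,2s\}$ into pairs $(e_i,f_i)$, $e_i<f_i$, $1\le i\le s$, with $\{f_1-e_1,\dots,f_s-e_s\}=\{m,m+1,\dots,m+s-1\}$. Its corresponding blocks are $\{0,\,e_i+m+s-1,\,f_i+m+s-1\}$, $1\le i\le s$. **Theorem 3.8.** For each $h\in\{37,40,41,43\}$ and for each integer $h\ge 44$ there exist integers $s\ge 0$, $t\ge 1$ with $h=s+2t$ and a $(6h+1,\{3,4\},1)$-PDF $\mathcal B$ of type $3^s4^t$ with $\theta=\frac{t}{s+t}\ge\frac1{14}$ such that the blocks of $\mathcal B$ of size $4$ are exactly the blocks $B_i(3s)=\{0,a_i,3s+b_i,3s+c_i\}$, $1\le i\le t$, of a variable $(12t+1,4,1)$-PDF, and the blocks of $\mathcal B$ of size $3$ are exactly the corresponding blocks $\{0,\,e_i+s+2t,\,f_i+s+2t\}$, $1\le i\le s$, of a $\mathrm{PLS}(s,2t+1)$. -/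

import Mathlib

/-- The directed list of differences of a block: the multiset of all integers `p - q`
with `p, q` in the block and `q < p`. -/
def blockDiffs (C : Finset ℕ) : Multiset ℕ :=
  ((C ×ˢ C).filter (fun p => p.2 < p.1)).val.map (fun p => p.1 - p.2)

/-- The directed list of differences of a collection of blocks, with multiplicities. -/
def familyDiffs (𝓑 : Finset (Finset ℕ)) : Multiset ℕ :=
  ∑ C ∈ 𝓑, blockDiffs C

/-- `𝓑` is a `(v, K, 1)` perfect difference family, `v` odd. The elements of `ℤ_v` are represented by
`0, 1, …, v - 1`, and the differences are differences of integers: their list is exactly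
`1, 2, …, (v - 1) / 2`, each once. (In particular no block of size at least `2` can be repeated, so
that the collection of blocks is a set.) -/
structure IsPDF (v : ℕ) (K : Set ℕ) (𝓑 : Finset (Finset ℕ)) : Prop where
  odd : Odd v
  subset : ∀ C ∈ 𝓑, C ⊆ Finset.range v
  card_mem : ∀ C ∈ 𝓑, C.card ∈ K
  cover : familyDiffs 𝓑 = (Finset.Icc 1 ((v - 1) / 2)).val

/-- The blocks of `𝓑` of size `k`. -/
def blocksOfSize (k : ℕ) (𝓑 : Finset (Finset ℕ)) : Finset (Finset ℕ) :=
  𝓑.filter (fun C => C.card = k)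

/-- `𝓑` is a `(g, {3, 4}, 1)`-PDF of type `3^s 4^t`, where `s ≥ 0` and `t ≥ 1`. -/
structure IsPDFOfType (g s t : ℕ) (𝓑 : Finset (Finset ℕ)) : Prop where
  isPDF : IsPDF g {3, 4} 𝓑
  t_pos : 1 ≤ t
  card_three : (blocksOfSize 3 𝓑).card = s
  card_four : (blocksOfSize 4 𝓑).card = t

/-- The collection `B(x)` of the blocks `B_i(x) = {0, a_i, x + b_i, x + c_i}`. -/
def shiftedBlocks {t : ℕ} (a b c : Fin t → ℕ) (x : ℕ) : Finset (Finset ℕ) :=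
  Finset.univ.image (fun i => ({0, a i, x + b i, x + c i} : Finset ℕ))

/-- The blocks `B_i = {0, a_i, b_i, c_i}`, `i = 1, …, t`, form a variable `(12t+1, 4, 1)`-PDF: they
form a `(12t+1, 4, 1)`-PDF, and for every value `x ≥ 0` of the variable the differences of `B(x)`
cover `[1, 2t] ∪ [x + 2t + 1, x + 6t]`, each element exactly once. -/
structure IsVariablePDF (t : ℕ) (a b c : Fin t → ℕ) : Prop where
  lt : ∀ i, 0 < a i ∧ a i < b i ∧ b i < c i
  isPDF : IsPDF (12 * t + 1) {4} (shiftedBlocks a b c 0)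
  cover : ∀ x : ℕ, familyDiffs (shiftedBlocks a b c x) =
    (Finset.Icc 1 (2 * t) ∪ Finset.Icc (x + 2 * t + 1) (x + 6 * t)).val

/-- The pairs `(e_i, f_i)`, `i = 1, …, s`, exhibit `{m, m + 1, …, m + s - 1}` as a perfect Langford
sequence `PLS(s, m)`: they are disjoint and partition `{1, …, 2s}`, and the differences `f_i - e_i`
are exactly `m, m + 1, …, m + s - 1`. -/
structure IsPLS (s m : ℕ) (e f : Fin s → ℕ) : Prop where
  lt : ∀ i, e i < f i
  pairs : Finset.univ.val.map e + Finset.univ.val.map f = (Finset.Icc 1 (2 * s)).val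
  diffs : Finset.univ.val.map (fun i => f i - e i) = (Finset.Ico m (m + s)).val

/-- The blocks `{0, e_i + z, f_i + z}` corresponding to a perfect Langford sequence `PLS(s, m)`,
where `z = m + s - 1`. -/
def plsBlocks {s : ℕ} (m : ℕ) (e f : Fin s → ℕ) : Finset (Finset ℕ) :=
  Finset.univ.image (fun i => ({0, e i + (m + s - 1), f i + (m + s - 1)} : Finset ℕ))

/-! In a block `{0, a, x + b, x + c}` only `a` and `d = c - b` are differences free of `x`. The
other four, `x + b - a`, `x + b`, `x + c - a`, `x + c`, form a translate of a parallelogram `{y, y +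
a, y + d, y + a + d}`. A variable PDF with `t` blocks therefore arises from a partition of an
interval of `4t` integers into `t` parallelograms whose sides are `1, …, 2t`. For `x = 3s` its
differences miss exactly `[2t + 1, 2t + 3s]` inside `[1, 3h]`, and the blocks of a `PLS(s, 2t + 1)`
fill this gap: the `f - e` take the first `s` values, the shifted positions the last `2s`.

It remains to choose `t` so that a tiling exists, a Langford sequence of order `s = h - 2t` and
defect `2t + 1` exists, and `s ≤ 13t`, which is the bound on the ratio.
`langfordTriplesEven_isLangford` and `langfordTriplesOdd_isLangford` give the sequences for `s = 4r`
and `s = 4r + 1` with `t + 2 ≤ r`. Hence `t` serves the `h` in `[6t + 8, 15t]` for which `h - 2t` is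
`0` or `1` modulo `4`, a condition on the parity of `t`. `IsParallelogramTiling.quintuple` passes
from `t` to `5t + 1`; starting from `t = 6, 7, 10, 15, 16`, the intervals of each parity leave no
gaps. The few small `h` below them use explicit Langford sequences.

All exactness is obtained by counting (`Multiset.eq_val_of_card_le`), so the two structures below
ask only for the right length and for every value to be attained. -/

/-- A Langford sequence of order `s` and defect `m`, given as a list of pairs: the `s` pairs contain
all of `1, …, 2 * s`, and their differences attain all of `m, …, m + s - 1`. -/
structure IsLangford (s m : ℕ) (L : List (ℕ × ℕ)) : Prop where
  length : L.length = s
  positions : ∀ n, 1 ≤ n → n ≤ 2 * s → ∃ x ∈ L, n = x.1 ∨ n = x.2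
  diffs : ∀ n, m ≤ n → n < m + s → ∃ x ∈ L, x.1 + n = x.2

/-- A partition of `0, …, 4 * t - 1` into `t` parallelograms `{y, y + a, y + d, y + a + d}`, given as
a list of triples `(y, a, d)`, whose sides `a`, `d` attain all of `1, …, 2 * t`. -/
structure IsParallelogramTiling (t : ℕ) (L : List (ℕ × ℕ × ℕ)) : Prop where
  length : L.length = t
  pos : ∀ x ∈ L, 1 ≤ x.2.1 ∧ 1 ≤ x.2.2
  sides : ∀ n, 1 ≤ n → n ≤ 2 * t → ∃ x ∈ L, n = x.2.1 ∨ n = x.2.2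
  points : ∀ n < 4 * t, ∃ x ∈ L,
    n = x.1 ∨ n = x.1 + x.2.1 ∨ n = x.1 + x.2.2 ∨ n = x.1 + x.2.1 + x.2.2

/-! ### Langford sequences built from nested pairs -/

/-- The pairs `(p, q), (p - 1, q + 1), …, (p - (k - 1), q + (k - 1))` for each triple `(p, q, k)` of
the list. -/
def nestedPairs (G : List (ℕ × ℕ × ℕ)) : List (ℕ × ℕ) :=
  G.flatMap fun g => (List.range g.2.2).map fun i => (g.1 - i, g.2.1 + i)

theorem length_nestedPairs (G : List (ℕ × ℕ × ℕ)) :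
    (nestedPairs G).length = (G.map fun g => g.2.2).sum := by
  simp [nestedPairs, List.length_flatMap]

theorem mem_nestedPairs {G : List (ℕ × ℕ × ℕ)} {p q k : ℕ} (j : ℕ) (hG : G[j]? = some (p, q, k))
    {i : ℕ} (hi : i < k) : (p - i, q + i) ∈ nestedPairs G :=
  List.mem_flatMap.2 ⟨_, List.mem_of_getElem? hG, List.mem_map.2 ⟨i, List.mem_range.2 hi, rfl⟩⟩

theorem exists_left_nestedPairs {G : List (ℕ × ℕ × ℕ)} {p q k n : ℕ} (j : ℕ)
    (hG : G[j]? = some (p, q, k)) (hn : n ≤ p) (hk : p < n + k) :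
    ∃ x ∈ nestedPairs G, n = x.1 ∨ n = x.2 :=
  ⟨_, mem_nestedPairs j hG (i := p - n) (by omega), Or.inl (by dsimp only; omega)⟩

theorem exists_right_nestedPairs {G : List (ℕ × ℕ × ℕ)} {p q k n : ℕ} (j : ℕ)
    (hG : G[j]? = some (p, q, k)) (hn : q ≤ n) (hk : n < q + k) :
    ∃ x ∈ nestedPairs G, n = x.1 ∨ n = x.2 :=
  ⟨_, mem_nestedPairs j hG (i := n - q) (by omega), Or.inr (by dsimp only; omega)⟩

/-- Moving outwards by one step raises the difference by `2`, so a group yields a run of differences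
of one parity starting at `q - p`. The bound `k ≤ p` keeps `p - i` from being truncated. -/
theorem exists_diff_nestedPairs {G : List (ℕ × ℕ × ℕ)} {p q k n : ℕ} (j : ℕ)
    (hG : G[j]? = some (p, q, k)) (hk : k ≤ p)
    (hn : q ≤ n + p ∧ n + p < q + 2 * k ∧ (n + p) % 2 = q % 2) :
    ∃ x ∈ nestedPairs G, x.1 + n = x.2 :=
  ⟨_, mem_nestedPairs j hG (i := (n + p - q) / 2) (by omega), by dsimp only; omega⟩

/-- Nested pairs forming a Langford sequence of order `4 * r` and defect `2 * u + 1`. -/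
def langfordTriplesEven (r u : ℕ) : List (ℕ × ℕ × ℕ) :=
  [(2 * r - 1, 2 * r + 2 * u + 2, r - u - 2),
   (r + u - 1, 3 * r + u + 1, r - 1),
   (u - 1, 4 * r + u + 2, u - 2),
   (2 * r + 2 * u, 6 * r + 1, u - 1),
   (2 * r + u, 6 * r + u + 2, u - 1),
   (6 * r - 1, 6 * r + 2 * u + 3, r - u - 2),
   (5 * r + u - 1, 7 * r + u + 2, r - u - 2),
   (1, 4 * r + 2 * u, 1),
   (u, 4 * r + u + 1, 1),
   (r + u, 5 * r + u, 1),
   (r + u + 1, 3 * r + u, 1),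
   (2 * r, 2 * r + 2 * u + 1, 1),
   (2 * r + 1, 6 * r + 2 * u + 1, 1),
   (2 * r + u + 1, 6 * r + u, 1),
   (4 * r + u, 6 * r + u + 1, 1),
   (4 * r + 2 * u + 1, 8 * r, 1),
   (5 * r + u + 1, 7 * r + u + 1, 1),
   (6 * r, 6 * r + 2 * u + 2, 1)]

/-- The left and right halves of the groups are intervals that tile `[1, 8r]`, and the runs of
differences tile the even and the odd part of `[2u + 1, 2u + 4r]`. The hypotheses make all group
sizes honest; some groups are empty when `u = 2` or `r = u + 2`. -/
theorem langfordTriplesEven_isLangford {r u : ℕ} (hu : 2 ≤ u) (hr : u + 2 ≤ r) :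
    IsLangford (4 * r) (2 * u + 1) (nestedPairs (langfordTriplesEven r u)) where
  length := by
    simp only [length_nestedPairs, langfordTriplesEven, List.map_cons, List.map_nil, List.sum_cons,
      List.sum_nil]
    omega
  positions n hn hn2 := by
    -- The thresholds are the right ends of the successive intervals, from left to right.
    obtain h | h := Nat.lt_or_ge 1 n
    on_goal 2 => exact exists_left_nestedPairs 7 rfl (by omega) (by omega)
    obtain h | h := Nat.lt_or_ge (u - 1) n
    on_goal 2 => exact exists_left_nestedPairs 2 rfl (by omega) (by omega)
    obtain h | h := Nat.lt_or_ge u n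
    on_goal 2 => exact exists_left_nestedPairs 8 rfl (by omega) (by omega)
    obtain h | h := Nat.lt_or_ge (r + u - 1) n
    on_goal 2 => exact exists_left_nestedPairs 1 rfl (by omega) (by omega)
    obtain h | h := Nat.lt_or_ge (r + u) n
    on_goal 2 => exact exists_left_nestedPairs 9 rfl (by omega) (by omega)
    obtain h | h := Nat.lt_or_ge (r + u + 1) n
    on_goal 2 => exact exists_left_nestedPairs 10 rfl (by omega) (by omega)
    obtain h | h := Nat.lt_or_ge (2 * r - 1) n
    on_goal 2 => exact exists_left_nestedPairs 0 rfl (by omega) (by omega)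
    obtain h | h := Nat.lt_or_ge (2 * r) n
    on_goal 2 => exact exists_left_nestedPairs 11 rfl (by omega) (by omega)
    obtain h | h := Nat.lt_or_ge (2 * r + 1) n
    on_goal 2 => exact exists_left_nestedPairs 12 rfl (by omega) (by omega)
    obtain h | h := Nat.lt_or_ge (2 * r + u) n
    on_goal 2 => exact exists_left_nestedPairs 4 rfl (by omega) (by omega)
    obtain h | h := Nat.lt_or_ge (2 * r + u + 1) n
    on_goal 2 => exact exists_left_nestedPairs 13 rfl (by omega) (by omega)
    obtain h | h := Nat.lt_or_ge (2 * r + 2 * u) n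
    on_goal 2 => exact exists_left_nestedPairs 3 rfl (by omega) (by omega)
    obtain h | h := Nat.lt_or_ge (2 * r + 2 * u + 1) n
    on_goal 2 => exact exists_right_nestedPairs 11 rfl (by omega) (by omega)
    obtain h | h := Nat.lt_or_ge (3 * r + u - 1) n
    on_goal 2 => exact exists_right_nestedPairs 0 rfl (by omega) (by omega)
    obtain h | h := Nat.lt_or_ge (3 * r + u) n
    on_goal 2 => exact exists_right_nestedPairs 10 rfl (by omega) (by omega)
    obtain h | h := Nat.lt_or_ge (4 * r + u - 1) n
    on_goal 2 => exact exists_right_nestedPairs 1 rfl (by omega) (by omega)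
    obtain h | h := Nat.lt_or_ge (4 * r + u) n
    on_goal 2 => exact exists_left_nestedPairs 14 rfl (by omega) (by omega)
    obtain h | h := Nat.lt_or_ge (4 * r + u + 1) n
    on_goal 2 => exact exists_right_nestedPairs 8 rfl (by omega) (by omega)
    obtain h | h := Nat.lt_or_ge (4 * r + 2 * u - 1) n
    on_goal 2 => exact exists_right_nestedPairs 2 rfl (by omega) (by omega)
    obtain h | h := Nat.lt_or_ge (4 * r + 2 * u) n
    on_goal 2 => exact exists_right_nestedPairs 7 rfl (by omega) (by omega)
    obtain h | h := Nat.lt_or_ge (4 * r + 2 * u + 1) n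
    on_goal 2 => exact exists_left_nestedPairs 15 rfl (by omega) (by omega)
    obtain h | h := Nat.lt_or_ge (5 * r + u - 1) n
    on_goal 2 => exact exists_left_nestedPairs 6 rfl (by omega) (by omega)
    obtain h | h := Nat.lt_or_ge (5 * r + u) n
    on_goal 2 => exact exists_right_nestedPairs 9 rfl (by omega) (by omega)
    obtain h | h := Nat.lt_or_ge (5 * r + u + 1) n
    on_goal 2 => exact exists_left_nestedPairs 16 rfl (by omega) (by omega)
    obtain h | h := Nat.lt_or_ge (6 * r - 1) n
    on_goal 2 => exact exists_left_nestedPairs 5 rfl (by omega) (by omega)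
    obtain h | h := Nat.lt_or_ge (6 * r) n
    on_goal 2 => exact exists_left_nestedPairs 17 rfl (by omega) (by omega)
    obtain h | h := Nat.lt_or_ge (6 * r + u - 1) n
    on_goal 2 => exact exists_right_nestedPairs 3 rfl (by omega) (by omega)
    obtain h | h := Nat.lt_or_ge (6 * r + u) n
    on_goal 2 => exact exists_right_nestedPairs 13 rfl (by omega) (by omega)
    obtain h | h := Nat.lt_or_ge (6 * r + u + 1) n
    on_goal 2 => exact exists_right_nestedPairs 14 rfl (by omega) (by omega)
    obtain h | h := Nat.lt_or_ge (6 * r + 2 * u) n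
    on_goal 2 => exact exists_right_nestedPairs 4 rfl (by omega) (by omega)
    obtain h | h := Nat.lt_or_ge (6 * r + 2 * u + 1) n
    on_goal 2 => exact exists_right_nestedPairs 12 rfl (by omega) (by omega)
    obtain h | h := Nat.lt_or_ge (6 * r + 2 * u + 2) n
    on_goal 2 => exact exists_right_nestedPairs 17 rfl (by omega) (by omega)
    obtain h | h := Nat.lt_or_ge (7 * r + u) n
    on_goal 2 => exact exists_right_nestedPairs 5 rfl (by omega) (by omega)
    obtain h | h := Nat.lt_or_ge (7 * r + u + 1) n
    on_goal 2 => exact exists_right_nestedPairs 16 rfl (by omega) (by omega)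
    obtain h | h := Nat.lt_or_ge (8 * r - 1) n
    on_goal 2 => exact exists_right_nestedPairs 6 rfl (by omega) (by omega)
    exact exists_right_nestedPairs 15 rfl (by omega) (by omega)
  diffs n hn hn2 := by
    -- Each group produces differences of a single parity, so the two parities are swept separately.
    obtain hpar | hpar := Nat.mod_two_eq_zero_or_one n
    · obtain h | h := Nat.lt_or_ge (2 * u + 2) n
      on_goal 2 => exact exists_diff_nestedPairs 17 rfl (by omega) (by omega)
      obtain h | h := Nat.lt_or_ge (2 * r - 2) n
      on_goal 2 => exact exists_diff_nestedPairs 5 rfl (by omega) (by omega)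
      obtain h | h := Nat.lt_or_ge (2 * r) n
      on_goal 2 => exact exists_diff_nestedPairs 16 rfl (by omega) (by omega)
      obtain h | h := Nat.lt_or_ge (4 * r - 2) n
      on_goal 2 => exact exists_diff_nestedPairs 1 rfl (by omega) (by omega)
      obtain h | h := Nat.lt_or_ge (4 * r) n
      on_goal 2 => exact exists_diff_nestedPairs 9 rfl (by omega) (by omega)
      obtain h | h := Nat.lt_or_ge (4 * r + 2 * u - 2) n
      on_goal 2 => exact exists_diff_nestedPairs 4 rfl (by omega) (by omega)
      exact exists_diff_nestedPairs 12 rfl (by omega) (by omega)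
    · obtain h | h := Nat.lt_or_ge (2 * u + 1) n
      on_goal 2 => exact exists_diff_nestedPairs 11 rfl (by omega) (by omega)
      obtain h | h := Nat.lt_or_ge (2 * r - 3) n
      on_goal 2 => exact exists_diff_nestedPairs 0 rfl (by omega) (by omega)
      obtain h | h := Nat.lt_or_ge (2 * r - 1) n
      on_goal 2 => exact exists_diff_nestedPairs 10 rfl (by omega) (by omega)
      obtain h | h := Nat.lt_or_ge (2 * r + 1) n
      on_goal 2 => exact exists_diff_nestedPairs 14 rfl (by omega) (by omega)
      obtain h | h := Nat.lt_or_ge (4 * r - 2 * u - 3) n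
      on_goal 2 => exact exists_diff_nestedPairs 6 rfl (by omega) (by omega)
      obtain h | h := Nat.lt_or_ge (4 * r - 2 * u - 1) n
      on_goal 2 => exact exists_diff_nestedPairs 15 rfl (by omega) (by omega)
      obtain h | h := Nat.lt_or_ge (4 * r - 3) n
      on_goal 2 => exact exists_diff_nestedPairs 3 rfl (by omega) (by omega)
      obtain h | h := Nat.lt_or_ge (4 * r - 1) n
      on_goal 2 => exact exists_diff_nestedPairs 13 rfl (by omega) (by omega)
      obtain h | h := Nat.lt_or_ge (4 * r + 1) n
      on_goal 2 => exact exists_diff_nestedPairs 8 rfl (by omega) (by omega)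
      obtain h | h := Nat.lt_or_ge (4 * r + 2 * u - 3) n
      on_goal 2 => exact exists_diff_nestedPairs 2 rfl (by omega) (by omega)
      exact exists_diff_nestedPairs 7 rfl (by omega) (by omega)

/-- Nested pairs forming a Langford sequence of order `4 * r + 1` and defect `2 * u + 1`. -/
def langfordTriplesOdd (r u : ℕ) : List (ℕ × ℕ × ℕ) :=
  [(2 * r - 1, 2 * r + 2 * u + 3, r - u - 2),
   (r + u - 1, 3 * r + u + 2, r - 1),
   (u - 1, 4 * r + u + 3, u - 2),
   (2 * r + 2 * u + 1, 6 * r + 3, u - 1),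
   (2 * r + u, 6 * r + u + 3, u - 1),
   (6 * r + 1, 6 * r + 2 * u + 4, r - u - 1),
   (5 * r + u + 1, 7 * r + u + 3, r - u),
   (1, 4 * r + 2 * u + 1, 1),
   (u, 4 * r + u + 1, 1),
   (r + u, 5 * r + u + 2, 1),
   (r + u + 1, 3 * r + u + 1, 1),
   (2 * r, 2 * r + 2 * u + 2, 1),
   (2 * r + 1, 6 * r + 2 * u + 2, 1),
   (2 * r + u + 1, 4 * r + u + 2, 1),
   (2 * r + u + 2, 6 * r + u + 2, 1),
   (6 * r + 2, 6 * r + 2 * u + 3, 1)]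

theorem langfordTriplesOdd_isLangford {r u : ℕ} (hu : 2 ≤ u) (hr : u + 2 ≤ r) :
    IsLangford (4 * r + 1) (2 * u + 1) (nestedPairs (langfordTriplesOdd r u)) where
  length := by
    simp only [length_nestedPairs, langfordTriplesOdd, List.map_cons, List.map_nil, List.sum_cons,
      List.sum_nil]
    omega
  positions n hn hn2 := by
    obtain h | h := Nat.lt_or_ge 1 n
    on_goal 2 => exact exists_left_nestedPairs 7 rfl (by omega) (by omega)
    obtain h | h := Nat.lt_or_ge (u - 1) n
    on_goal 2 => exact exists_left_nestedPairs 2 rfl (by omega) (by omega)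
    obtain h | h := Nat.lt_or_ge u n
    on_goal 2 => exact exists_left_nestedPairs 8 rfl (by omega) (by omega)
    obtain h | h := Nat.lt_or_ge (r + u - 1) n
    on_goal 2 => exact exists_left_nestedPairs 1 rfl (by omega) (by omega)
    obtain h | h := Nat.lt_or_ge (r + u) n
    on_goal 2 => exact exists_left_nestedPairs 9 rfl (by omega) (by omega)
    obtain h | h := Nat.lt_or_ge (r + u + 1) n
    on_goal 2 => exact exists_left_nestedPairs 10 rfl (by omega) (by omega)
    obtain h | h := Nat.lt_or_ge (2 * r - 1) n
    on_goal 2 => exact exists_left_nestedPairs 0 rfl (by omega) (by omega)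
    obtain h | h := Nat.lt_or_ge (2 * r) n
    on_goal 2 => exact exists_left_nestedPairs 11 rfl (by omega) (by omega)
    obtain h | h := Nat.lt_or_ge (2 * r + 1) n
    on_goal 2 => exact exists_left_nestedPairs 12 rfl (by omega) (by omega)
    obtain h | h := Nat.lt_or_ge (2 * r + u) n
    on_goal 2 => exact exists_left_nestedPairs 4 rfl (by omega) (by omega)
    obtain h | h := Nat.lt_or_ge (2 * r + u + 1) n
    on_goal 2 => exact exists_left_nestedPairs 13 rfl (by omega) (by omega)
    obtain h | h := Nat.lt_or_ge (2 * r + u + 2) n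
    on_goal 2 => exact exists_left_nestedPairs 14 rfl (by omega) (by omega)
    obtain h | h := Nat.lt_or_ge (2 * r + 2 * u + 1) n
    on_goal 2 => exact exists_left_nestedPairs 3 rfl (by omega) (by omega)
    obtain h | h := Nat.lt_or_ge (2 * r + 2 * u + 2) n
    on_goal 2 => exact exists_right_nestedPairs 11 rfl (by omega) (by omega)
    obtain h | h := Nat.lt_or_ge (3 * r + u) n
    on_goal 2 => exact exists_right_nestedPairs 0 rfl (by omega) (by omega)
    obtain h | h := Nat.lt_or_ge (3 * r + u + 1) n
    on_goal 2 => exact exists_right_nestedPairs 10 rfl (by omega) (by omega)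
    obtain h | h := Nat.lt_or_ge (4 * r + u) n
    on_goal 2 => exact exists_right_nestedPairs 1 rfl (by omega) (by omega)
    obtain h | h := Nat.lt_or_ge (4 * r + u + 1) n
    on_goal 2 => exact exists_right_nestedPairs 8 rfl (by omega) (by omega)
    obtain h | h := Nat.lt_or_ge (4 * r + u + 2) n
    on_goal 2 => exact exists_right_nestedPairs 13 rfl (by omega) (by omega)
    obtain h | h := Nat.lt_or_ge (4 * r + 2 * u) n
    on_goal 2 => exact exists_right_nestedPairs 2 rfl (by omega) (by omega)
    obtain h | h := Nat.lt_or_ge (4 * r + 2 * u + 1) n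
    on_goal 2 => exact exists_right_nestedPairs 7 rfl (by omega) (by omega)
    obtain h | h := Nat.lt_or_ge (5 * r + u + 1) n
    on_goal 2 => exact exists_left_nestedPairs 6 rfl (by omega) (by omega)
    obtain h | h := Nat.lt_or_ge (5 * r + u + 2) n
    on_goal 2 => exact exists_right_nestedPairs 9 rfl (by omega) (by omega)
    obtain h | h := Nat.lt_or_ge (6 * r + 1) n
    on_goal 2 => exact exists_left_nestedPairs 5 rfl (by omega) (by omega)
    obtain h | h := Nat.lt_or_ge (6 * r + 2) n
    on_goal 2 => exact exists_left_nestedPairs 15 rfl (by omega) (by omega)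
    obtain h | h := Nat.lt_or_ge (6 * r + u + 1) n
    on_goal 2 => exact exists_right_nestedPairs 3 rfl (by omega) (by omega)
    obtain h | h := Nat.lt_or_ge (6 * r + u + 2) n
    on_goal 2 => exact exists_right_nestedPairs 14 rfl (by omega) (by omega)
    obtain h | h := Nat.lt_or_ge (6 * r + 2 * u + 1) n
    on_goal 2 => exact exists_right_nestedPairs 4 rfl (by omega) (by omega)
    obtain h | h := Nat.lt_or_ge (6 * r + 2 * u + 2) n
    on_goal 2 => exact exists_right_nestedPairs 12 rfl (by omega) (by omega)
    obtain h | h := Nat.lt_or_ge (6 * r + 2 * u + 3) n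
    on_goal 2 => exact exists_right_nestedPairs 15 rfl (by omega) (by omega)
    obtain h | h := Nat.lt_or_ge (7 * r + u + 2) n
    on_goal 2 => exact exists_right_nestedPairs 5 rfl (by omega) (by omega)
    exact exists_right_nestedPairs 6 rfl (by omega) (by omega)
  diffs n hn hn2 := by
    obtain hpar | hpar := Nat.mod_two_eq_zero_or_one n
    · obtain h | h := Nat.lt_or_ge (2 * u + 2) n
      on_goal 2 => exact exists_diff_nestedPairs 11 rfl (by omega) (by omega)
      obtain h | h := Nat.lt_or_ge (2 * r - 2) n
      on_goal 2 => exact exists_diff_nestedPairs 0 rfl (by omega) (by omega)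
      obtain h | h := Nat.lt_or_ge (2 * r) n
      on_goal 2 => exact exists_diff_nestedPairs 10 rfl (by omega) (by omega)
      obtain h | h := Nat.lt_or_ge (4 * r - 2 * u) n
      on_goal 2 => exact exists_diff_nestedPairs 6 rfl (by omega) (by omega)
      obtain h | h := Nat.lt_or_ge (4 * r - 2) n
      on_goal 2 => exact exists_diff_nestedPairs 3 rfl (by omega) (by omega)
      obtain h | h := Nat.lt_or_ge (4 * r) n
      on_goal 2 => exact exists_diff_nestedPairs 14 rfl (by omega) (by omega)
      obtain h | h := Nat.lt_or_ge (4 * r + 2) n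
      on_goal 2 => exact exists_diff_nestedPairs 9 rfl (by omega) (by omega)
      obtain h | h := Nat.lt_or_ge (4 * r + 2 * u - 2) n
      on_goal 2 => exact exists_diff_nestedPairs 2 rfl (by omega) (by omega)
      exact exists_diff_nestedPairs 7 rfl (by omega) (by omega)
    · obtain h | h := Nat.lt_or_ge (2 * u + 1) n
      on_goal 2 => exact exists_diff_nestedPairs 15 rfl (by omega) (by omega)
      obtain h | h := Nat.lt_or_ge (2 * r - 1) n
      on_goal 2 => exact exists_diff_nestedPairs 5 rfl (by omega) (by omega)
      obtain h | h := Nat.lt_or_ge (2 * r + 1) n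
      on_goal 2 => exact exists_diff_nestedPairs 13 rfl (by omega) (by omega)
      obtain h | h := Nat.lt_or_ge (4 * r - 1) n
      on_goal 2 => exact exists_diff_nestedPairs 1 rfl (by omega) (by omega)
      obtain h | h := Nat.lt_or_ge (4 * r + 1) n
      on_goal 2 => exact exists_diff_nestedPairs 8 rfl (by omega) (by omega)
      obtain h | h := Nat.lt_or_ge (4 * r + 2 * u - 1) n
      on_goal 2 => exact exists_diff_nestedPairs 4 rfl (by omega) (by omega)
      exact exists_diff_nestedPairs 12 rfl (by omega) (by omega)

/-! ### Explicit tilings and Langford sequences -/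

/-- With all quantifiers bounded, an explicit list can be checked by `decide`. -/
theorem IsLangford.of_ball {s m : ℕ} {L : List (ℕ × ℕ)}
    (h : L.length = s ∧ (∀ n < 2 * s, ∃ x ∈ L, n + 1 = x.1 ∨ n + 1 = x.2) ∧
      ∀ n < s, ∃ x ∈ L, x.1 + (m + n) = x.2) : IsLangford s m L where
  length := h.1
  positions n hn hn2 := by
    obtain ⟨k, rfl⟩ := Nat.exists_eq_add_of_le' hn
    exact h.2.1 k (by omega)
  diffs n hn hn2 := by
    obtain ⟨k, rfl⟩ := Nat.exists_eq_add_of_le hn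
    exact h.2.2 k (by omega)

theorem IsParallelogramTiling.of_ball {t : ℕ} {L : List (ℕ × ℕ × ℕ)}
    (h : L.length = t ∧ (∀ x ∈ L, 1 ≤ x.2.1 ∧ 1 ≤ x.2.2) ∧
      (∀ n < 2 * t, ∃ x ∈ L, n + 1 = x.2.1 ∨ n + 1 = x.2.2) ∧
      ∀ n < 4 * t, ∃ x ∈ L,
        n = x.1 ∨ n = x.1 + x.2.1 ∨ n = x.1 + x.2.2 ∨ n = x.1 + x.2.1 + x.2.2) :
    IsParallelogramTiling t L where
  length := h.1
  pos := h.2.1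
  sides n hn hn2 := by
    obtain ⟨k, rfl⟩ := Nat.exists_eq_add_of_le' hn
    exact h.2.2.1 k (by omega)
  points := h.2.2.2

set_option maxRecDepth 4000 in
theorem exists_isParallelogramTiling_six : ∃ L, IsParallelogramTiling 6 L :=
  ⟨[(0, 1, 2), (8, 3, 9), (5, 4, 10), (7, 5, 11), (4, 6, 12), (6, 7, 8)],
    .of_ball (by decide)⟩

set_option maxRecDepth 4000 in
theorem exists_isParallelogramTiling_seven : ∃ L, IsParallelogramTiling 7 L :=
  ⟨[(0, 1, 4), (14, 2, 9), (8, 3, 13), (2, 5, 11), (6, 6, 14), (3, 7, 12), (9, 8, 10)],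
    .of_ball (by decide)⟩

set_option maxRecDepth 4000 in
theorem exists_isParallelogramTiling_ten : ∃ L, IsParallelogramTiling 10 L :=
  ⟨[(25, 1, 12), (3, 2, 3), (0, 4, 13), (10, 5, 19), (22, 6, 11), (7, 7, 17), (11, 8, 16), (9,
    9, 14), (2, 10, 18), (1, 15, 20)],
    .of_ball (by decide)⟩

set_option maxRecDepth 4000 in
theorem exists_isParallelogramTiling_fifteen : ∃ L, IsParallelogramTiling 15 L :=
  ⟨[(13, 5, 30), (0, 14, 17), (2, 4, 26), (3, 6, 12), (10, 10, 27), (1, 7, 11), (4, 20, 21),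
    (5, 25, 28), (11, 16, 29), (26, 9, 24), (7, 15, 22), (16, 18, 23), (38, 3, 8), (23, 13,
    19), (51, 1, 2)],
    .of_ball (by decide)⟩

set_option maxRecDepth 4000 in
theorem exists_isParallelogramTiling_sixteen : ∃ L, IsParallelogramTiling 16 L :=
  ⟨[(7, 23, 32), (0, 24, 31), (1, 4, 14), (2, 11, 15), (3, 20, 26), (6, 16, 30), (4, 8, 29),
    (9, 2, 7), (10, 10, 27), (14, 21, 28), (25, 9, 25), (8, 13, 19), (26, 17, 18), (48, 3, 5),
    (45, 1, 12), (32, 6, 22)],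
    .of_ball (by decide)⟩

set_option maxRecDepth 4000 in
theorem exists_isLangford_25_13 : ∃ L, IsLangford 25 13 L :=
  ⟨[(1, 29), (2, 32), (3, 34), (4, 28), (5, 31), (6, 27), (7, 44), (8, 26), (9, 42), (10, 46),
    (11, 30), (12, 47), (13, 35), (14, 41), (15, 49), (16, 48), (17, 37), (18, 43), (19, 36),
    (20, 33), (21, 50), (22, 45), (23, 38), (24, 40), (25, 39)],
    .of_ball (by decide)⟩

set_option maxRecDepth 4000 in
theorem exists_isLangford_28_13 : ∃ L, IsLangford 28 13 L :=
  ⟨[(1, 40), (2, 35), (3, 43), (4, 29), (5, 36), (6, 34), (7, 39), (8, 38), (9, 25), (10, 46),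
    (11, 33), (12, 26), (13, 28), (14, 52), (15, 44), (16, 51), (17, 30), (18, 55), (19, 45),
    (20, 47), (21, 41), (22, 56), (23, 42), (24, 48), (27, 50), (31, 49), (32, 53), (37, 54)],
    .of_ball (by decide)⟩

set_option maxRecDepth 4000 in
theorem exists_isLangford_29_13 : ∃ L, IsLangford 29 13 L :=
  ⟨[(1, 42), (2, 30), (3, 25), (4, 41), (5, 37), (6, 46), (7, 43), (8, 34), (9, 23), (10, 44),
    (11, 49), (12, 28), (13, 38), (14, 29), (15, 39), (16, 33), (17, 56), (18, 45), (19, 48),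
    (20, 53), (21, 51), (22, 57), (24, 55), (26, 47), (27, 40), (31, 50), (32, 52), (35, 58),
    (36, 54)],
    .of_ball (by decide)⟩

set_option maxRecDepth 4000 in
theorem exists_isLangford_29_15 : ∃ L, IsLangford 29 15 L :=
  ⟨[(1, 36), (2, 42), (3, 44), (4, 38), (5, 34), (6, 48), (7, 31), (8, 33), (9, 35), (10, 47),
    (11, 32), (12, 30), (13, 45), (14, 57), (15, 54), (16, 52), (17, 55), (18, 51), (19, 50),
    (20, 39), (21, 41), (22, 37), (23, 46), (24, 40), (25, 53), (26, 43), (27, 49), (28, 58),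
    (29, 56)],
    .of_ball (by decide)⟩

set_option maxRecDepth 4000 in
theorem exists_isLangford_32_15 : ∃ L, IsLangford 32 15 L :=
  ⟨[(1, 43), (2, 45), (3, 41), (4, 40), (5, 35), (6, 51), (7, 39), (8, 28), (9, 31), (10, 27),
    (11, 42), (12, 46), (13, 59), (14, 30), (15, 50), (16, 53), (17, 61), (18, 58), (19, 38),
    (20, 44), (21, 48), (22, 63), (23, 56), (24, 47), (25, 64), (26, 52), (29, 54), (32, 60),
    (33, 62), (34, 49), (36, 57), (37, 55)],
    .of_ball (by decide)⟩

set_option maxRecDepth 4000 in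
theorem exists_isLangford_33_15 : ∃ L, IsLangford 33 15 L :=
  ⟨[(1, 17), (2, 46), (3, 32), (4, 49), (5, 48), (6, 47), (7, 39), (8, 33), (9, 31), (10, 40),
    (11, 37), (12, 51), (13, 59), (14, 50), (15, 38), (16, 56), (18, 60), (19, 66), (20, 54),
    (21, 52), (22, 55), (23, 42), (24, 62), (25, 43), (26, 53), (27, 64), (28, 45), (29, 44),
    (30, 65), (34, 58), (35, 63), (36, 57), (41, 61)],
    .of_ball (by decide)⟩

/-! ### From a tiling with `t` parallelograms to one with `5t + 1` -/

/-- The parallelograms obtained from `(y, a, d)` by multiplying by `5` and adding an additive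
sequence of permutations of `{-2, …, 2}`. -/
def quintuple (x : ℕ × ℕ × ℕ) : List (ℕ × ℕ × ℕ) :=
  [(5 * x.1, 5 * x.2.1, 5 * x.2.2), (5 * x.1 + 1, 5 * x.2.1 + 1, 5 * x.2.2 + 2),
    (5 * x.1 + 2, 5 * x.2.1 + 2, 5 * x.2.2 - 1), (5 * x.1 + 3, 5 * x.2.1 - 2, 5 * x.2.2 + 1),
    (5 * x.1 + 4, 5 * x.2.1 - 1, 5 * x.2.2 - 2)]

/-- In row `i` the offsets of `y`, `y + a`, `y + d`, `y + a + d` are the residues of `i, 2i, 3i, 4i`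
modulo `5` in `{0, …, 4}`, so each old point `p` becomes `5p, …, 5p + 4`. The offsets of `a` and of
`d` each run through `-2, …, 2`, so the old sides produce `3, …, 10t + 2`. The extra parallelogram
`(20t, 1, 2)` supplies the sides `1, 2` and the last four points. -/
theorem IsParallelogramTiling.quintuple {t : ℕ} {L : List (ℕ × ℕ × ℕ)}
    (hL : IsParallelogramTiling t L) :
    IsParallelogramTiling (5 * t + 1) ((20 * t, 1, 2) :: L.flatMap quintuple) := by
  have mem {x z : ℕ × ℕ × ℕ} (hx : x ∈ L) (j : ℕ) (hz : (_root_.quintuple x)[j]? = some z) :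
      z ∈ (20 * t, 1, 2) :: L.flatMap _root_.quintuple :=
    List.mem_cons_of_mem _ (List.mem_flatMap.2 ⟨x, hx, List.mem_of_getElem? hz⟩)
  refine ⟨?_, ?_, fun n hn hn2 => ?_, fun n hn => ?_⟩
  · simp [List.length_flatMap, _root_.quintuple, hL.length, mul_comm]
  · intro z hz
    rcases List.mem_cons.1 hz with rfl | hz
    · simp
    · obtain ⟨x, hx, hz⟩ := List.mem_flatMap.1 hz
      have := hL.pos x hx
      simp only [_root_.quintuple, List.mem_cons, List.not_mem_nil, or_false] at hz
      rcases hz with rfl | rfl | rfl | rfl | rfl <;> dsimp only <;> omega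
  · by_cases h2 : n ≤ 2
    · exact ⟨_, List.mem_cons_self, by dsimp only; omega⟩
    -- `(n + 2) / 5` is the old side `m` with `5m - 2 ≤ n ≤ 5m + 2`.
    obtain ⟨x, hx, h | h⟩ := hL.sides ((n + 2) / 5) (by omega) (by omega)
    · obtain hr | hr | hr | hr | hr : (n + 2) % 5 = 0 ∨ (n + 2) % 5 = 1 ∨ (n + 2) % 5 = 2 ∨
          (n + 2) % 5 = 3 ∨ (n + 2) % 5 = 4 := by omega
      · exact ⟨_, mem hx 3 rfl, Or.inl (by dsimp only; omega)⟩
      · exact ⟨_, mem hx 4 rfl, Or.inl (by dsimp only; omega)⟩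
      · exact ⟨_, mem hx 0 rfl, Or.inl (by dsimp only; omega)⟩
      · exact ⟨_, mem hx 1 rfl, Or.inl (by dsimp only; omega)⟩
      · exact ⟨_, mem hx 2 rfl, Or.inl (by dsimp only; omega)⟩
    · obtain hr | hr | hr | hr | hr : (n + 2) % 5 = 0 ∨ (n + 2) % 5 = 1 ∨ (n + 2) % 5 = 2 ∨
          (n + 2) % 5 = 3 ∨ (n + 2) % 5 = 4 := by omega
      · exact ⟨_, mem hx 4 rfl, Or.inr (by dsimp only; omega)⟩
      · exact ⟨_, mem hx 2 rfl, Or.inr (by dsimp only; omega)⟩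
      · exact ⟨_, mem hx 0 rfl, Or.inr (by dsimp only; omega)⟩
      · exact ⟨_, mem hx 3 rfl, Or.inr (by dsimp only; omega)⟩
      · exact ⟨_, mem hx 1 rfl, Or.inr (by dsimp only; omega)⟩
  · by_cases h2 : 20 * t ≤ n
    · exact ⟨_, List.mem_cons_self, by dsimp only; omega⟩
    have hr : n % 5 = 0 ∨ n % 5 = 1 ∨ n % 5 = 2 ∨ n % 5 = 3 ∨ n % 5 = 4 := by omega
    obtain ⟨x, hx, h⟩ := hL.points (n / 5) (by omega)
    have := hL.pos x hx
    obtain h | h | h | h := h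
    · rcases hr with hr | hr | hr | hr | hr
      · exact ⟨_, mem hx 0 rfl, Or.inl (by dsimp only; omega)⟩
      · exact ⟨_, mem hx 1 rfl, Or.inl (by dsimp only; omega)⟩
      · exact ⟨_, mem hx 2 rfl, Or.inl (by dsimp only; omega)⟩
      · exact ⟨_, mem hx 3 rfl, Or.inl (by dsimp only; omega)⟩
      · exact ⟨_, mem hx 4 rfl, Or.inl (by dsimp only; omega)⟩
    · rcases hr with hr | hr | hr | hr | hr
      · exact ⟨_, mem hx 0 rfl, Or.inr (Or.inl (by dsimp only; omega))⟩
      · exact ⟨_, mem hx 3 rfl, Or.inr (Or.inl (by dsimp only; omega))⟩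
      · exact ⟨_, mem hx 1 rfl, Or.inr (Or.inl (by dsimp only; omega))⟩
      · exact ⟨_, mem hx 4 rfl, Or.inr (Or.inl (by dsimp only; omega))⟩
      · exact ⟨_, mem hx 2 rfl, Or.inr (Or.inl (by dsimp only; omega))⟩
    · rcases hr with hr | hr | hr | hr | hr
      · exact ⟨_, mem hx 0 rfl, Or.inr (Or.inr (Or.inl (by dsimp only; omega)))⟩
      · exact ⟨_, mem hx 2 rfl, Or.inr (Or.inr (Or.inl (by dsimp only; omega)))⟩
      · exact ⟨_, mem hx 4 rfl, Or.inr (Or.inr (Or.inl (by dsimp only; omega)))⟩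
      · exact ⟨_, mem hx 1 rfl, Or.inr (Or.inr (Or.inl (by dsimp only; omega)))⟩
      · exact ⟨_, mem hx 3 rfl, Or.inr (Or.inr (Or.inl (by dsimp only; omega)))⟩
    · rcases hr with hr | hr | hr | hr | hr
      · exact ⟨_, mem hx 0 rfl, Or.inr (Or.inr (Or.inr (by dsimp only; omega)))⟩
      · exact ⟨_, mem hx 4 rfl, Or.inr (Or.inr (Or.inr (by dsimp only; omega)))⟩
      · exact ⟨_, mem hx 3 rfl, Or.inr (Or.inr (Or.inr (by dsimp only; omega)))⟩
      · exact ⟨_, mem hx 2 rfl, Or.inr (Or.inr (Or.inr (by dsimp only; omega)))⟩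
      · exact ⟨_, mem hx 1 rfl, Or.inr (Or.inr (Or.inr (by dsimp only; omega)))⟩

/-! ### Choice of `t` -/

/-- The map from `t` to `5t + 1` reverses parity, so the two claims must be proved together. -/
theorem exists_even_and_odd_isParallelogramTiling (h : ℕ) :
    (44 ≤ h → ∃ t L, IsParallelogramTiling t L ∧ t % 2 = 0 ∧ 6 * t + 8 ≤ h ∧ h ≤ 15 * t) ∧
    (50 ≤ h → ∃ t L, IsParallelogramTiling t L ∧ t % 2 = 1 ∧ 6 * t + 8 ≤ h ∧ h ≤ 15 * t) := by
  induction h using Nat.strong_induction_on with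
  | _ h ih =>
    by_cases hbig : 224 ≤ h
    -- If `(h + 26) / 5` lies in `[6t + 8, 15t]`, then `h` lies in `[30t + 14, 75t + 15]`, the
    -- interval of `5t + 1`. The bound `224 ≤ h` makes `(h + 26) / 5` at least `50`.
    · obtain ⟨t, L, hL, ht⟩ := (ih ((h + 26) / 5) (by omega)).1 (by omega)
      obtain ⟨t', L', hL', ht'⟩ := (ih ((h + 26) / 5) (by omega)).2 (by omega)
      exact ⟨fun _ => ⟨_, _, hL'.quintuple, by omega⟩, fun _ => ⟨_, _, hL.quintuple, by omega⟩⟩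
    · obtain ⟨L6, h6⟩ := exists_isParallelogramTiling_six
      obtain ⟨L7, h7⟩ := exists_isParallelogramTiling_seven
      obtain ⟨L10, h10⟩ := exists_isParallelogramTiling_ten
      obtain ⟨L15, h15⟩ := exists_isParallelogramTiling_fifteen
      obtain ⟨L16, h16⟩ := exists_isParallelogramTiling_sixteen
      -- The intervals of `6, 10, 16` are `[44, 90]`, `[68, 150]`, `[104, 240]`; those of `7, 15`
      -- are `[50, 105]`, `[98, 225]`.
      refine ⟨fun hh => ?_, fun hh => ?_⟩
      · by_cases h1 : h ≤ 90
        · exact ⟨_, _, h6, by omega⟩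
        by_cases h2 : h ≤ 150
        · exact ⟨_, _, h10, by omega⟩
        · exact ⟨_, _, h16, by omega⟩
      · by_cases h1 : h ≤ 105
        · exact ⟨_, _, h7, by omega⟩
        · exact ⟨_, _, h15, by omega⟩

theorem exists_isParallelogramTiling_and_isLangford (h : ℕ)
    (hh : h ∈ ({37, 40, 41, 43} : Set ℕ) ∨ 44 ≤ h) :
    ∃ s t L M, IsParallelogramTiling t L ∧ IsLangford s (2 * t + 1) M ∧ h = s + 2 * t ∧
      1 ≤ t ∧ s ≤ 13 * t := by
  simp only [Set.mem_insert_iff, Set.mem_singleton_iff] at hh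
  have hmin : 37 ≤ h := by omega
  obtain ⟨L6, h6⟩ := exists_isParallelogramTiling_six
  obtain ⟨L7, h7⟩ := exists_isParallelogramTiling_seven
  -- The lower bound on `h` gives `t + 2 ≤ r`, the upper one `s ≤ 13t`.
  have general {t L} (hL : IsParallelogramTiling t L) (hpar : (h - 2 * t) % 4 < 2)
      (h1 : 6 * t + 8 ≤ h) (h2 : h ≤ 15 * t) :
      ∃ s t L M, IsParallelogramTiling t L ∧ IsLangford s (2 * t + 1) M ∧ h = s + 2 * t ∧
        1 ≤ t ∧ s ≤ 13 * t := by
    obtain ⟨r, hr | hr⟩ : ∃ r, h - 2 * t = 4 * r ∨ h - 2 * t = 4 * r + 1 :=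
      ⟨(h - 2 * t) / 4, by omega⟩
    · exact ⟨_, t, L, _, hL, langfordTriplesEven_isLangford (r := r) (by omega) (by omega),
        by omega⟩
    · exact ⟨_, t, L, _, hL, langfordTriplesOdd_isLangford (r := r) (by omega) (by omega),
        by omega⟩
  -- In the six cases that follow, `t + 2 ≤ r` fails for the chosen `t`. The orders `25` and `29`,
  -- for `t = 6` and `t = 7`, equal `4t + 1`, the least order possible for defect `2t + 1`.
  by_cases h0 : h = 37
  · obtain ⟨M, hM⟩ := exists_isLangford_25_13
    exact ⟨_, _, _, _, h6, hM, by omega⟩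
  by_cases h0 : h = 40
  · obtain ⟨M, hM⟩ := exists_isLangford_28_13
    exact ⟨_, _, _, _, h6, hM, by omega⟩
  by_cases h0 : h = 41
  · obtain ⟨M, hM⟩ := exists_isLangford_29_13
    exact ⟨_, _, _, _, h6, hM, by omega⟩
  by_cases h0 : h = 43
  · obtain ⟨M, hM⟩ := exists_isLangford_29_15
    exact ⟨_, _, _, _, h7, hM, by omega⟩
  by_cases h0 : h = 46
  · obtain ⟨M, hM⟩ := exists_isLangford_32_15
    exact ⟨_, _, _, _, h7, hM, by omega⟩
  by_cases h0 : h = 47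
  · obtain ⟨M, hM⟩ := exists_isLangford_33_15
    exact ⟨_, _, _, _, h7, hM, by omega⟩
  -- `h - 2t` must be `0` or `1` modulo `4`, so `t` is even here and odd in the other case.
  by_cases hpar : h % 4 < 2
  · obtain ⟨t, L, hL, ht⟩ := (exists_even_and_odd_isParallelogramTiling h).1 (by omega)
    exact general hL (by omega) (by omega) (by omega)
  · obtain ⟨t, L, hL, ht⟩ := (exists_even_and_odd_isParallelogramTiling h).2 (by omega)
    exact general hL (by omega) (by omega) (by omega)

/-! ### Lists of differences -/

/-- Attaining every element of `S` with at most `S.card` entries leaves no room for repetitions or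
for other elements. -/
theorem Multiset.eq_val_of_card_le {α : Type*} {M : Multiset α} {S : Finset α}
    (hc : M.card ≤ S.card) (h : ∀ x ∈ S, x ∈ M) : M = S.val :=
  (Multiset.eq_of_le_of_card_le ((Multiset.le_iff_subset S.nodup).2 h) hc).symm

theorem blockDiffs_insert {z : ℕ} {C : Finset ℕ} (h : ∀ x ∈ C, z < x) :
    blockDiffs (insert z C) = C.val.map (fun x => x - z) + blockDiffs C := by
  have hz : z ∉ C := fun hz => (h z hz).false
  have hd : Disjoint (C ×ˢ {z}) ((C ×ˢ C).filter fun p => p.2 < p.1) := by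
    rw [Finset.disjoint_left]
    rintro ⟨p, q⟩ hp hq
    simp only [Finset.mem_product, Finset.mem_singleton, Finset.mem_filter] at hp hq
    exact hz (hp.2 ▸ hq.1.2)
  have key : ((insert z C ×ˢ insert z C).filter fun p => p.2 < p.1) =
      (C ×ˢ {z}).disjUnion ((C ×ˢ C).filter fun p => p.2 < p.1) hd := by
    ext ⟨p, q⟩
    simp only [Finset.mem_filter, Finset.mem_product, Finset.mem_insert, Finset.mem_disjUnion,
      Finset.mem_singleton]
    constructor
    · rintro ⟨⟨rfl | hp, rfl | hq⟩, hlt⟩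
      · exact absurd hlt (lt_irrefl _)
      · exact absurd hlt (h q hq).asymm
      · exact Or.inl ⟨hp, rfl⟩
      · exact Or.inr ⟨⟨hp, hq⟩, hlt⟩
    · rintro (⟨hp, rfl⟩ | ⟨⟨hp, hq⟩, hlt⟩)
      · exact ⟨⟨Or.inr hp, Or.inl rfl⟩, h p hp⟩
      · exact ⟨⟨Or.inr hp, Or.inr hq⟩, hlt⟩
  rw [blockDiffs, key, Finset.disjUnion_val, Multiset.map_add]
  simp [blockDiffs, Finset.product_val]

@[simp]
theorem blockDiffs_singleton (z : ℕ) : blockDiffs {z} = 0 := by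
  simp [blockDiffs]

theorem blockDiffs_three {p q : ℕ} (hp : 0 < p) (hq : p < q) :
    blockDiffs {0, p, q} = {p, q, q - p} := by
  rw [blockDiffs_insert (by simp; omega), blockDiffs_insert (by simp; omega), blockDiffs_singleton,
    Finset.insert_val_of_notMem (by simp; omega)]
  simp

theorem blockDiffs_four {p q r : ℕ} (hp : 0 < p) (hq : p < q) (hr : q < r) :
    blockDiffs {0, p, q, r} = {p, q, r, q - p, r - p, r - q} := by
  rw [blockDiffs_insert (by simp; omega), blockDiffs_insert (by simp; omega),
    blockDiffs_insert (by simp; omega), blockDiffs_singleton,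
    Finset.insert_val_of_notMem (by simp; omega), Finset.insert_val_of_notMem (by simp; omega)]
  simp only [Multiset.map_cons, Multiset.map_singleton, Finset.singleton_val,
    Multiset.insert_eq_cons, Nat.sub_zero, add_zero]
  simp only [← Multiset.singleton_add]
  abel

/-- Since `0` lies in every block, a bound on the differences also bounds the elements; this gives
the inclusion of the blocks in `Finset.range v`. -/
theorem mem_familyDiffs {𝓑 : Finset (Finset ℕ)} {C : Finset ℕ} {p : ℕ} (hC : C ∈ 𝓑)
    (h0 : 0 ∈ C) (hp : p ∈ C) (hpos : 0 < p) : p ∈ familyDiffs 𝓑 :=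
  Multiset.mem_sum.2 ⟨C, hC, Multiset.mem_map.2 ⟨(p, 0), by simp [*], rfl⟩⟩

theorem familyDiffs_image {n : ℕ} {B : Fin n → Finset ℕ} (hB : Function.Injective B) :
    familyDiffs (Finset.univ.image B) = ∑ i, blockDiffs (B i) :=
  Finset.sum_image hB.injOn

/-! ### Blocks of size 3 from Langford sequences -/

theorem IsLangford.exists_isPLS {s m : ℕ} {M : List (ℕ × ℕ)} (hM : IsLangford s m M) (hm : 0 < m) :
    ∃ e f : Fin s → ℕ, IsPLS s m e f := by
  obtain rfl := hM.length
  have hd : Finset.univ.val.map (fun i => (M.get i).2 - (M.get i).1) =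
      (Finset.Ico m (m + M.length)).val := by
    refine Multiset.eq_val_of_card_le (by simp) fun n hn => ?_
    obtain ⟨x, hx, h⟩ := hM.diffs n (Finset.mem_Ico.1 hn).1 (Finset.mem_Ico.1 hn).2
    obtain ⟨i, rfl⟩ := List.mem_iff_get.1 hx
    exact Multiset.mem_map.2 ⟨i, Finset.mem_univ_val i, by omega⟩
  refine ⟨fun i => (M.get i).1, fun i => (M.get i).2, fun i => ?_, ?_, hd⟩
  -- The truncated difference is at least `m > 0`, which forces `e i < f i`.
  · have := hd ▸ Multiset.mem_map_of_mem (fun i => (M.get i).2 - (M.get i).1)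
      (Finset.mem_univ_val i)
    rw [Finset.mem_val, Finset.mem_Ico] at this
    omega
  · refine Multiset.eq_val_of_card_le (by simp; omega) fun n hn => ?_
    obtain ⟨x, hx, h⟩ := hM.positions n (Finset.mem_Icc.1 hn).1 (Finset.mem_Icc.1 hn).2
    obtain ⟨i, rfl⟩ := List.mem_iff_get.1 hx
    rw [Multiset.mem_add]
    exact h.imp (fun h => Multiset.mem_map.2 ⟨i, Finset.mem_univ_val i, h.symm⟩)
      (fun h => Multiset.mem_map.2 ⟨i, Finset.mem_univ_val i, h.symm⟩)

theorem IsPLS.pos {s m : ℕ} {e f : Fin s → ℕ} (h : IsPLS s m e f) (i : Fin s) : 0 < e i := by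
  have : e i ∈ (Finset.Icc 1 (2 * s)).val :=
    h.pairs ▸ Multiset.mem_add.2 (Or.inl (Multiset.mem_map_of_mem e (Finset.mem_univ_val i)))
  rw [Finset.mem_val, Finset.mem_Icc] at this
  exact this.1

theorem IsPLS.block_injective {s m : ℕ} {e f : Fin s → ℕ} (h : IsPLS s m e f) (z : ℕ) :
    Function.Injective fun i => ({0, e i + z, f i + z} : Finset ℕ) := by
  have hnd : (Finset.univ.val.map e + Finset.univ.val.map f).Nodup := h.pairs ▸ Finset.nodup _
  rw [Multiset.nodup_add] at hnd
  intro i j hij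
  have hmem : e i + z ∈ ({0, e j + z, f j + z} : Finset ℕ) := by
    beta_reduce at hij
    rw [← hij]
    simp
  have hpos := h.pos i
  simp only [Finset.mem_insert, Finset.mem_singleton] at hmem
  obtain hmem | hmem | hmem := hmem
  · omega
  · exact Multiset.inj_on_of_nodup_map hnd.1 i (Finset.mem_univ_val i) j (Finset.mem_univ_val j)
      (by omega)
  · have he := Multiset.mem_map_of_mem e (Finset.mem_univ_val i)
    have hf := Multiset.mem_map_of_mem f (Finset.mem_univ_val j)
    rw [show f j = e i by omega] at hf
    exact absurd hf (Multiset.disjoint_left.1 hnd.2.2 he)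

theorem IsPLS.familyDiffs_plsBlocks {s m : ℕ} {e f : Fin s → ℕ} (h : IsPLS s m e f) (hm : 0 < m) :
    familyDiffs (plsBlocks m e f) = (Finset.Ico m (m + 3 * s)).val := by
  rw [plsBlocks, familyDiffs_image (h.block_injective _)]
  refine Multiset.eq_val_of_card_le ?_ fun n hn => ?_
  · simp [blockDiffs_three (Nat.add_pos_left (h.pos _) _) (Nat.add_lt_add_right (h.lt _) _),
      mul_comm]
  · simp only [blockDiffs_three (Nat.add_pos_left (h.pos _) _) (Nat.add_lt_add_right (h.lt _) _),
      Multiset.mem_sum, Finset.mem_univ, true_and, Multiset.insert_eq_cons, Multiset.mem_cons,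
      Multiset.mem_singleton]
    rw [Finset.mem_Ico] at hn
    by_cases hns : n < m + s
    · have : n ∈ Finset.univ.val.map fun i => f i - e i := by
        rw [h.diffs]
        exact Finset.mem_Ico.2 ⟨hn.1, hns⟩
      obtain ⟨i, -, hi⟩ := Multiset.mem_map.1 this
      exact ⟨i, by omega⟩
    · have : n - (m + s - 1) ∈ Finset.univ.val.map e + Finset.univ.val.map f := by
        rw [h.pairs, Finset.mem_val, Finset.mem_Icc]
        omega
      obtain this | this := Multiset.mem_add.1 this <;>
        obtain ⟨i, -, hi⟩ := Multiset.mem_map.1 this <;> exact ⟨i, by omega⟩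

theorem IsPLS.card_eq_and_zero_mem {s m : ℕ} {e f : Fin s → ℕ} (h : IsPLS s m e f)
    {C : Finset ℕ} (hC : C ∈ plsBlocks m e f) : C.card = 3 ∧ 0 ∈ C := by
  obtain ⟨i, -, rfl⟩ := Finset.mem_image.1 hC
  have := h.pos i
  have := h.lt i
  refine ⟨Finset.card_eq_three.2 ⟨_, _, _, ?_, ?_, ?_, rfl⟩, by simp⟩ <;> omega

theorem card_eq_and_zero_mem_of_mem_shiftedBlocks {t x : ℕ} {a b c : Fin t → ℕ}
    (h : ∀ i, 0 < a i ∧ a i < b i ∧ b i < c i) {C : Finset ℕ} (hC : C ∈ shiftedBlocks a b c x) :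
    C.card = 4 ∧ 0 ∈ C := by
  obtain ⟨i, -, rfl⟩ := Finset.mem_image.1 hC
  have := h i
  refine ⟨?_, by simp⟩
  rw [Finset.card_insert_of_notMem (by simp; omega), Finset.card_eq_three.2]
  exact ⟨_, _, _, by omega, by omega, by omega, rfl⟩

/-! ### Blocks of size 4 from parallelogram tilings -/

/-- The triple `(y, a, d)` gives `b = y + a + (2t + 1)` and `c = b + d`: the long differences are
the points of the parallelogram moved by `x + 2t + 1`. -/
theorem IsParallelogramTiling.exists_isVariablePDF {t : ℕ} {L : List (ℕ × ℕ × ℕ)}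
    (hL : IsParallelogramTiling t L) :
    ∃ a b c : Fin t → ℕ, IsVariablePDF t a b c ∧
      ∀ x, Function.Injective fun i => ({0, a i, x + b i, x + c i} : Finset ℕ) := by
  obtain rfl := hL.length
  have hsides : Finset.univ.val.map (fun i => (L.get i).2.1) +
      Finset.univ.val.map (fun i => (L.get i).2.2) = (Finset.Icc 1 (2 * L.length)).val := by
    refine Multiset.eq_val_of_card_le (by simp; omega) fun n hn => ?_
    obtain ⟨x, hx, h⟩ := hL.sides n (Finset.mem_Icc.1 hn).1 (Finset.mem_Icc.1 hn).2
    obtain ⟨i, rfl⟩ := List.mem_iff_get.1 hx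
    rw [Multiset.mem_add]
    exact h.imp (fun h => Multiset.mem_map.2 ⟨i, Finset.mem_univ_val i, h.symm⟩)
      (fun h => Multiset.mem_map.2 ⟨i, Finset.mem_univ_val i, h.symm⟩)
  have hnd : Function.Injective fun i => (L.get i).2.1 := by
    have : (Finset.univ.val.map fun i => (L.get i).2.1).Nodup :=
      Multiset.nodup_of_le (Multiset.le_add_right _ _) (hsides ▸ Finset.nodup _)
    exact fun i j => Multiset.inj_on_of_nodup_map this i (Finset.mem_univ_val i) j
      (Finset.mem_univ_val j)
  have ha (i) : (L.get i).2.1 ≤ 2 * L.length := by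
    have : (L.get i).2.1 ∈ (Finset.Icc 1 (2 * L.length)).val :=
      hsides ▸ Multiset.mem_add.2 (Or.inl (Multiset.mem_map_of_mem _ (Finset.mem_univ_val i)))
    rw [Finset.mem_val, Finset.mem_Icc] at this
    exact this.2
  have hpos (i) := hL.pos _ (L.get_mem i)
  -- The side `a i ≤ 2t` is the only nonzero element of its block below `2t + 1`, and distinct
  -- blocks have distinct sides.
  have hinj (x : ℕ) : Function.Injective fun i => ({0, (L.get i).2.1,
      x + ((L.get i).1 + (L.get i).2.1 + (2 * L.length + 1)),
      x + ((L.get i).1 + (L.get i).2.1 + (L.get i).2.2 + (2 * L.length + 1))} : Finset ℕ) := by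
    intro i j hij
    have hmem : (L.get i).2.1 ∈ ({0, (L.get j).2.1,
      x + ((L.get j).1 + (L.get j).2.1 + (2 * L.length + 1)),
      x + ((L.get j).1 + (L.get j).2.1 + (L.get j).2.2 + (2 * L.length + 1))} : Finset ℕ) := by
      beta_reduce at hij
      rw [← hij]
      simp
    simp only [Finset.mem_insert, Finset.mem_singleton] at hmem
    have := hpos i
    have := ha i
    exact hnd (show (L.get i).2.1 = (L.get j).2.1 by omega)
  have hcover (x : ℕ) : familyDiffs (shiftedBlocks (fun i => (L.get i).2.1)
      (fun i => (L.get i).1 + (L.get i).2.1 + (2 * L.length + 1))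
      (fun i => (L.get i).1 + (L.get i).2.1 + (L.get i).2.2 + (2 * L.length + 1)) x) =
      (Finset.Icc 1 (2 * L.length) ∪
        Finset.Icc (x + 2 * L.length + 1) (x + 6 * L.length)).val := by
    rw [shiftedBlocks, familyDiffs_image (hinj x)]
    have hd (i) := blockDiffs_four (p := (L.get i).2.1)
      (q := x + ((L.get i).1 + (L.get i).2.1 + (2 * L.length + 1)))
      (r := x + ((L.get i).1 + (L.get i).2.1 + (L.get i).2.2 + (2 * L.length + 1)))
      (hpos i).1 (by omega) (by have := hpos i; omega)
    simp only [hd]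
    refine Multiset.eq_val_of_card_le ?_ fun n hn => ?_
    · rw [Finset.card_union_of_disjoint]
      · simp
        omega
      · rw [Finset.disjoint_left]
        simp only [Finset.mem_Icc]
        omega
    · simp only [Multiset.mem_sum, Finset.mem_univ, true_and, Multiset.insert_eq_cons,
        Multiset.mem_cons, Multiset.mem_singleton]
      rw [Finset.mem_union, Finset.mem_Icc, Finset.mem_Icc] at hn
      obtain hn | hn := hn
      · obtain ⟨y, hy, h⟩ := hL.sides n hn.1 hn.2
        obtain ⟨i, rfl⟩ := List.mem_iff_get.1 hy
        exact ⟨i, by omega⟩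
      · obtain ⟨y, hy, h⟩ := hL.points (n - (x + 2 * L.length + 1)) (by omega)
        obtain ⟨i, rfl⟩ := List.mem_iff_get.1 hy
        exact ⟨i, by omega⟩
  have hlt (i) : 0 < (L.get i).2.1 ∧
      (L.get i).2.1 < (L.get i).1 + (L.get i).2.1 + (2 * L.length + 1) ∧
      (L.get i).1 + (L.get i).2.1 + (2 * L.length + 1) <
        (L.get i).1 + (L.get i).2.1 + (L.get i).2.2 + (2 * L.length + 1) := by
    have := hpos i
    omega
  have hunion : Finset.Icc 1 (2 * L.length) ∪
      Finset.Icc (0 + 2 * L.length + 1) (0 + 6 * L.length) = Finset.Icc 1 (6 * L.length) := by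
    ext n
    simp only [Finset.mem_union, Finset.mem_Icc]
    omega
  refine ⟨_, _, _, ⟨hlt, ⟨⟨6 * L.length, by ring⟩, fun C hC p hp => ?_, fun C hC => ?_, ?_⟩,
    hcover⟩, hinj⟩
  · rw [Finset.mem_range]
    by_contra! hlarge
    have := mem_familyDiffs hC (card_eq_and_zero_mem_of_mem_shiftedBlocks hlt hC).2 hp (by omega)
    rw [hcover, hunion, Finset.mem_val, Finset.mem_Icc] at this
    omega
  · exact (card_eq_and_zero_mem_of_mem_shiftedBlocks hlt hC).1
  · rw [hcover, hunion, show (12 * L.length + 1 - 1) / 2 = 6 * L.length by omega]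

/-! ### Assembly -/

theorem theorem3p8 (h : ℕ) (hh : h ∈ ({37, 40, 41, 43} : Set ℕ) ∨ 44 ≤ h) :
    ∃ (s t : ℕ) (𝓑 : Finset (Finset ℕ)) (a b c : Fin t → ℕ) (e f : Fin s → ℕ),
      h = s + 2 * t ∧
      IsPDFOfType (6 * h + 1) s t 𝓑 ∧
      (1 / 14 : ℚ) ≤ (t : ℚ) / ((s : ℚ) + (t : ℚ)) ∧
      IsVariablePDF t a b c ∧
      blocksOfSize 4 𝓑 = shiftedBlocks a b c (3 * s) ∧
      IsPLS s (2 * t + 1) e f ∧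
      blocksOfSize 3 𝓑 = plsBlocks (2 * t + 1) e f := by
  obtain ⟨s, t, L, M, hL, hM, rfl, ht, hst⟩ := exists_isParallelogramTiling_and_isLangford h hh
  obtain ⟨a, b, c, habc, hinj⟩ := hL.exists_isVariablePDF
  obtain ⟨e, f, hef⟩ := hM.exists_isPLS (Nat.succ_pos _)
  have h4 {C} (hC : C ∈ shiftedBlocks a b c (3 * s)) :=
    card_eq_and_zero_mem_of_mem_shiftedBlocks habc.lt hC
  have h3 {C} (hC : C ∈ plsBlocks (2 * t + 1) e f) := hef.card_eq_and_zero_mem hC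
  have hdisj : Disjoint (shiftedBlocks a b c (3 * s)) (plsBlocks (2 * t + 1) e f) :=
    Finset.disjoint_left.2 fun C hC hC' => by
      have := (h4 hC).1
      have := (h3 hC').1
      omega
  have hmem {C} (hC : C ∈ shiftedBlocks a b c (3 * s) ∪ plsBlocks (2 * t + 1) e f) :
      (C.card = 3 ∨ C.card = 4) ∧ 0 ∈ C :=
    (Finset.mem_union.1 hC).elim (fun h => ⟨Or.inr (h4 h).1, (h4 h).2⟩)
      fun h => ⟨Or.inl (h3 h).1, (h3 h).2⟩
  have hfour : blocksOfSize 4 (shiftedBlocks a b c (3 * s) ∪ plsBlocks (2 * t + 1) e f) =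
      shiftedBlocks a b c (3 * s) := by
    rw [blocksOfSize, Finset.filter_union, Finset.filter_true_of_mem fun C hC => (h4 hC).1,
      Finset.filter_false_of_mem fun C hC => by simp [(h3 hC).1], Finset.union_empty]
  have hthree : blocksOfSize 3 (shiftedBlocks a b c (3 * s) ∪ plsBlocks (2 * t + 1) e f) =
      plsBlocks (2 * t + 1) e f := by
    rw [blocksOfSize, Finset.filter_union, Finset.filter_true_of_mem fun C hC => (h3 hC).1,
      Finset.filter_false_of_mem fun C hC => by simp [(h4 hC).1], Finset.empty_union]
  have hcover : familyDiffs (shiftedBlocks a b c (3 * s) ∪ plsBlocks (2 * t + 1) e f) =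
      (Finset.Icc 1 (3 * (s + 2 * t))).val := by
    rw [familyDiffs, Finset.sum_union hdisj, ← familyDiffs, ← familyDiffs, habc.cover,
      hef.familyDiffs_plsBlocks (Nat.succ_pos _)]
    -- `[1, 2t]`, `[2t + 1, 2t + 3s]` and `[3s + 2t + 1, 3s + 6t]` fit together, and `3s + 6t = 3h`.
    refine Multiset.eq_val_of_card_le ?_ fun n hn => ?_
    · rw [Multiset.card_add, Finset.card_val, Finset.card_val]
      refine (Nat.add_le_add_right (Finset.card_union_le _ _) _).trans ?_
      simp only [Nat.card_Icc, Nat.card_Ico]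
      omega
    · rw [Multiset.mem_add, Finset.mem_val, Finset.mem_val, Finset.mem_union, Finset.mem_Icc,
        Finset.mem_Icc, Finset.mem_Ico]
      rw [Finset.mem_Icc] at hn
      omega
  refine ⟨s, t, _, a, b, c, e, f, rfl, ⟨⟨⟨3 * (s + 2 * t), by ring⟩, fun C hC p hp => ?_,
    fun C hC => (hmem hC).1, ?_⟩, ht, ?_, ?_⟩, ?_, habc, hfour, hef, hthree⟩
  · rw [Finset.mem_range]
    by_contra! hlarge
    have := mem_familyDiffs hC (hmem hC).2 hp (by omega)
    rw [hcover, Finset.mem_val, Finset.mem_Icc] at this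
    omega
  · rw [hcover, show (6 * (s + 2 * t) + 1 - 1) / 2 = 3 * (s + 2 * t) by omega]
  · rw [hthree, plsBlocks, Finset.card_image_of_injective _ (hef.block_injective _),
      Finset.card_univ, Fintype.card_fin]
  · rw [hfour, shiftedBlocks, Finset.card_image_of_injective _ (hinj _), Finset.card_univ,
      Fintype.card_fin]
  · have ht' : (1 : ℚ) ≤ t := by exact_mod_cast ht
    have hst' : (s : ℚ) ≤ 13 * t := by exact_mod_cast hst
    have hs : (0 : ℚ) ≤ s := Nat.cast_nonneg s
    rw [div_le_div_iff₀ (by norm_num) (by linarith)]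
    linarith
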